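/- **Conventions.** Let $A=(a_1,\dots,a_n)$ be a real $m\times n$ matrix with columns $a_j\in\mathbb R^m$. For $S\subseteq[n]$ let $A|_S$ be the submatrix of $A$ formed by the columns indexed by $S$. For a matrix $B$ with $m$ rows and $k$ columns put $$\mathrm{disc}(B)=\min_{x\in\{-1,1\}^k}\|Bx\|_\infty,\qquad \mathrm{vecdisc}(B)=\min_{u_1,\dots,u_k\in\mathbb S^{k-1}}\ \max_{1\le i\le m}\Big\|\sum_{j=1}^k B_{ij}u_j\Big\|_2,$$ where $\mathbb S^{k-1}$ is the Euclidean unit sphere of $\mathbb R^k$ (both quantities are $0$ if $k=0$), and let $$\mathrm{herdisc}(A)=\max_{S\subseteq[n]}\mathrm{disc}(A|_S),\qquad \mathrm{hvecdisc}(A)=\max_{S\subseteq[n]}\mathrm{vecdisc}(A|_S).$$ Let $B_2^m$ be the closed Euclidean unit ball of $\mathbb R^m$, and for $E=FB_2^m$ with $F\in\mathbb R^{m\times m}$ let $\|E\|_\infty=\max_{x\in E}\|x\|_\infty$. **Theorem.** Let $A=(a_j)_{j=1}^n\in\mathbb R^{m\times n}$ and let $F\in\mathbb R^{m\times m}$ be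 a matrix of rank $m$ such that $a_j\in E=FB_2^m$ for every $j\in[n]$. Then $$\mathrm{hvecdisc}(A)\le\|E\|_\infty .$$ Moreover, there is a universal constant $C>0$, independent of $m$, $n$, $A$ and $F$, such that if $m\ge 2$, then $$\mathrm{herdisc}(A)\le C\sqrt{\log m}\;\|E\|_\infty .$$ -/

import Mathlib

open scoped Matrix

noncomputable section

namespace HerDisc

/-- Discrepancy of a real matrix whose columns are indexed by `ι`: the minimum over sign vectors
`x ∈ {-1, 1}^ι` of `‖A x‖_∞` (the norm of `Fin m → ℝ` is the maximum norm). -/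
def disc {m : ℕ} {ι : Type} [Fintype ι] (A : Matrix (Fin m) ι ℝ) : ℝ :=
  ⨅ x : {x : ι → ℝ // ∀ j, x j = 1 ∨ x j = -1}, ‖A *ᵥ (x : ι → ℝ)‖

/-- Vector discrepancy: the minimum, over assignments of Euclidean unit vectors
`u j ∈ ℝ^ι` to the columns `j`, of `max_i ‖∑ j, A i j • u j‖₂`. -/
def vecdisc {m : ℕ} {ι : Type} [Fintype ι] (A : Matrix (Fin m) ι ℝ) : ℝ :=
  ⨅ u : ι → Metric.sphere (0 : EuclideanSpace ℝ ι) 1,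
    ⨆ i : Fin m, ‖∑ j, A i j • (u j : EuclideanSpace ℝ ι)‖

/-- The submatrix `A|_S` formed by the columns of `A` indexed by `S`. -/
def restrictCols {m n : ℕ} (A : Matrix (Fin m) (Fin n) ℝ) (S : Finset (Fin n)) :
    Matrix (Fin m) S ℝ :=
  A.submatrix id (fun j : S => (j : Fin n))

/-- Hereditary discrepancy: the maximum of `disc (A|_S)` over all sets `S` of columns. -/
def herdisc {m n : ℕ} (A : Matrix (Fin m) (Fin n) ℝ) : ℝ :=
  ⨆ S : Finset (Fin n), disc (restrictCols A S)

/-- Hereditary vector discrepancy: the maximum of `vecdisc (A|_S)` over all sets `S` of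
columns. -/
def hvecdisc {m n : ℕ} (A : Matrix (Fin m) (Fin n) ℝ) : ℝ :=
  ⨆ S : Finset (Fin n), vecdisc (restrictCols A S)

/-- The ellipsoid `F B_2^m`, the image of the closed Euclidean unit ball under `F`. -/
def ellipsoid {m : ℕ} (F : Matrix (Fin m) (Fin m) ℝ) : Set (Fin m → ℝ) :=
  (fun v : EuclideanSpace ℝ (Fin m) => F *ᵥ v.ofLp) '' Metric.closedBall 0 1

/-- `‖E‖_∞`, the largest `ℓ_∞` norm of a point of `E`. -/
def linftyNorm {m : ℕ} (E : Set (Fin m → ℝ)) : ℝ :=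
  sSup ((fun x => ‖x‖) '' E)

/-! The infima and suprema above are attained, so they are the minima and maxima intended. -/

theorem disc_attained {m : ℕ} {ι : Type} [Fintype ι] (A : Matrix (Fin m) ι ℝ) :
    IsLeast {d | ∃ x : ι → ℝ, (∀ j, x j = 1 ∨ x j = -1) ∧ d = ‖A *ᵥ x‖} (disc A) := by
  have hfin : Finite {x : ι → ℝ // ∀ j, x j = 1 ∨ x j = -1} := by
    have h : (Set.univ.pi fun _ : ι => ({1, -1} : Set ℝ)).Finite :=
      Set.Finite.pi fun _ => Set.toFinite _
    refine (h.subset ?_).to_subtype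
    intro x hx j _
    simpa using hx j
  have hne : Nonempty {x : ι → ℝ // ∀ j, x j = 1 ∨ x j = -1} := ⟨⟨fun _ => 1, fun _ => Or.inl rfl⟩⟩
  constructor
  · obtain ⟨x, hx⟩ := exists_eq_ciInf_of_finite
      (f := fun x : {x : ι → ℝ // ∀ j, x j = 1 ∨ x j = -1} => ‖A *ᵥ (x : ι → ℝ)‖)
    exact ⟨x, x.2, hx.symm⟩
  · rintro d ⟨x, hx, rfl⟩
    exact ciInf_le (f := fun x : {x : ι → ℝ // ∀ j, x j = 1 ∨ x j = -1} => ‖A *ᵥ (x : ι → ℝ)‖)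
      (Set.finite_range _).bddBelow ⟨x, hx⟩

theorem vecdisc_attained {m : ℕ} {ι : Type} [Fintype ι] (A : Matrix (Fin m) ι ℝ) :
    IsLeast (Set.range fun u : ι → Metric.sphere (0 : EuclideanSpace ℝ ι) 1 =>
      ⨆ i : Fin m, ‖∑ j, A i j • (u j : EuclideanSpace ℝ ι)‖) (vecdisc A) := by
  classical
  have hne : Nonempty (ι → Metric.sphere (0 : EuclideanSpace ℝ ι) 1) :=
    ⟨fun j => ⟨EuclideanSpace.single j 1, by simp⟩⟩
  refine IsCompact.isLeast_sInf ?_ (Set.range_nonempty _)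
  refine isCompact_range ?_
  rcases isEmpty_or_nonempty (Fin m) with h | h
  · simpa using continuous_const
  · have : (fun u : ι → Metric.sphere (0 : EuclideanSpace ℝ ι) 1 =>
        ⨆ i : Fin m, ‖∑ j, A i j • (u j : EuclideanSpace ℝ ι)‖) =
        fun u => Finset.univ.sup' Finset.univ_nonempty
          fun i : Fin m => ‖∑ j, A i j • (u j : EuclideanSpace ℝ ι)‖ := by
      funext u
      exact (Finset.sup'_univ_eq_ciSup _).symm
    rw [this]
    refine Continuous.finset_sup'_apply _ ?_
    intro i _
    fun_prop

theorem herdisc_attained {m n : ℕ} (A : Matrix (Fin m) (Fin n) ℝ) :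
    IsGreatest (Set.range fun S : Finset (Fin n) => disc (restrictCols A S)) (herdisc A) :=
  (Set.finite_range _).isCompact.isGreatest_sSup (Set.range_nonempty _)

theorem hvecdisc_attained {m n : ℕ} (A : Matrix (Fin m) (Fin n) ℝ) :
    IsGreatest (Set.range fun S : Finset (Fin n) => vecdisc (restrictCols A S)) (hvecdisc A) :=
  (Set.finite_range _).isCompact.isGreatest_sSup (Set.range_nonempty _)

theorem linftyNorm_ellipsoid_attained {m : ℕ} (F : Matrix (Fin m) (Fin m) ℝ) :
    IsGreatest ((fun x => ‖x‖) '' ellipsoid F) (linftyNorm (ellipsoid F)) := by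
  refine IsCompact.isGreatest_sSup ?_ ?_
  · refine IsCompact.image ?_ continuous_norm
    refine (isCompact_closedBall _ _).image ?_
    exact Continuous.matrix_mulVec continuous_const (by fun_prop)
  · exact ((Metric.nonempty_closedBall.2 zero_le_one).image _).image _

end HerDisc

end

/-!
A point `a j = F *ᵥ v j` of the ellipsoid has the coordinates `⟪v j, f i⟫`, where `‖v j‖ ≤ 1` and
`f i` is the `i`-th row of `F`; and `‖f i‖ ≤ ‖E‖_∞`, because the `i`-th coordinate attains the
value `‖f i‖` on `E` (`norm_row_le_linftyNorm`). Both bounds then follow from a single fact about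
vectors `v j` in the unit ball (`exists_subgaussian_signs`): there are random signs `X` such that
`Y = ∑ j, X j • v j` satisfies, for all `θ`,
`E ⟪Y, θ⟫² ≤ ‖θ‖²` and `E exp ⟪Y, θ⟫ ≤ exp (290 * ‖θ‖²)`.

* The signs, seen as elements of `L²`, are unit vectors `u j` with
  `‖∑ j, A i j • u j‖² = E ⟪Y, f i⟫² ≤ ‖f i‖²`; only their Gram matrix matters, so they can be
  realised in a space whose dimension is the number of columns (`vecdisc_le_of_factorization`).
* The exponential bound at `θ = ± c • f i` and a union bound over the `m` rows give a sign vector of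
  discrepancy `O(√(log m) * ‖E‖_∞)` (`disc_le_of_factorization`).

The random signs come from the Gram–Schmidt walk of Bansal, Dadush, Garg and Lovett. It starts at
`0` in the cube `[-1, 1]^ι` and keeps a pivot `p` among the coordinates that are still alive
(`|x j| < 1`). Each step moves in a direction `u` with `u p = 1`, supported on the alive coordinates,
for which `∑ j, u j • v j` is the component of `v p` orthogonal to the other alive vectors; the step
has mean zero and is long enough to freeze a coordinate. A frozen pivot is replaced by a new one.
By induction on the number of alive coordinates, every potential of the walk
(`IsWalkPotential`) has final expectation at most its initial value (`exists_sign_distribution`).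

Let `W ⊆ Z` be the spans of the alive vectors without and with the pivot, let `w` and `z` be the
squared lengths of the projections of `θ` onto them, `q = z - w`, and let `a` be the inner product
of `θ` with the pivot residual, so that `a² ≤ q`. The covariance bound comes from the potential
`⟪∑ j, x j • v j, θ⟫² + w + (1 - x p²) * q`: a step `δ` adds `δ² * a²` to the square on average and
removes `δ² * q` from the last term, while the freezing of coordinates only shrinks `W` and `Z`.

The exponential bound uses the minimum of two potentials. For small `q` the factor
`1 + 2 * (1 - x p²) * q` plays the role of `(1 - x p²) * q` above. For large `q` the factor
`exp (|a| - x p * a)` makes the potential constant along a step; its change when `a` jumps to `a'`,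
at most `exp (2 * |a' - a|)`, is covered, by the inequality between arithmetic and geometric means,
by the growth of the residual's squared length, which stays at most `1`, and by the decrease of `w`
(`two_mul_abs_inner_pivotResidual_sub_le`).
-/

/-! ### Orthogonal projections onto nested subspaces -/

section Projections

variable {E : Type*} [NormedAddCommGroup E] [InnerProductSpace ℝ E]

theorem norm_starProjection_sub_sq_of_le {W Z : Submodule ℝ E} [W.HasOrthogonalProjection]
    [Z.HasOrthogonalProjection] (h : W ≤ Z) (θ : E) :
    ‖Z.starProjection θ - W.starProjection θ‖ ^ 2
      = ‖Z.starProjection θ‖ ^ 2 - ‖W.starProjection θ‖ ^ 2 := by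
  have hW : W.starProjection (Z.starProjection θ) = W.starProjection θ := by
    have := Submodule.starProjection_comp_starProjection_of_le h
    exact congrArg (fun f : E →L[ℝ] E => f θ) this
  have h1 : inner ℝ (Z.starProjection θ - W.starProjection θ) (W.starProjection θ) = 0 := by
    have := Submodule.starProjection_inner_eq_zero (K := W) (Z.starProjection θ)
      (W.starProjection θ) (Submodule.starProjection_apply_mem W θ)
    rwa [hW] at this
  rw [inner_sub_left, real_inner_self_eq_norm_sq] at h1
  rw [norm_sub_sq_real]
  linarith

theorem norm_starProjection_sq_mono {W Z : Submodule ℝ E} [W.HasOrthogonalProjection]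
    [Z.HasOrthogonalProjection] (h : W ≤ Z) (θ : E) :
    ‖W.starProjection θ‖ ^ 2 ≤ ‖Z.starProjection θ‖ ^ 2 := by
  have := norm_starProjection_sub_sq_of_le h θ
  nlinarith [sq_nonneg ‖Z.starProjection θ - W.starProjection θ‖]

/-- Cauchy–Schwarz inside the orthogonal complement of `W` in `Z`. -/
theorem inner_sq_le_of_mem_of_orthogonal {W Z : Submodule ℝ E} [W.HasOrthogonalProjection]
    [Z.HasOrthogonalProjection] (h : W ≤ Z) {c : E} (hc : c ∈ Z)
    (hcW : ∀ y ∈ W, inner ℝ c y = 0) (θ : E) :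
    inner ℝ c θ ^ 2 ≤ ‖c‖ ^ 2 * (‖Z.starProjection θ‖ ^ 2 - ‖W.starProjection θ‖ ^ 2) := by
  have h1 : inner ℝ c θ = inner ℝ c (Z.starProjection θ - W.starProjection θ) := by
    rw [inner_sub_right, hcW _ (Submodule.starProjection_apply_mem W θ), sub_zero,
      ← Submodule.inner_starProjection_left_eq_right, Submodule.starProjection_eq_self_iff.2 hc]
  rw [h1, ← norm_starProjection_sub_sq_of_le h, ← mul_pow]
  exact sq_le_sq' (by linarith [neg_abs_le (inner ℝ c (Z.starProjection θ - W.starProjection θ)),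
    abs_real_inner_le_norm c (Z.starProjection θ - W.starProjection θ)]) (real_inner_le_norm _ _)

end Projections

/-! ### The Gram–Schmidt walk -/

section Walk

variable {ι E : Type*} [NormedAddCommGroup E] [InnerProductSpace ℝ E]

/-- The span of the vectors of the alive coordinates of `x`, those with `|x j| < 1`. -/
def aliveSpan (v : ι → E) (x : ι → ℝ) : Submodule ℝ E :=
  Submodule.span ℝ (v '' {j | |x j| < 1})

/-- The span of the vectors of the alive coordinates of `x` other than the pivot `p`. -/
def nonpivotSpan (v : ι → E) (p : ι) (x : ι → ℝ) : Submodule ℝ E :=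
  Submodule.span ℝ (v '' {j | |x j| < 1 ∧ j ≠ p})

theorem nonpivotSpan_le_aliveSpan (v : ι → E) (p : ι) (x : ι → ℝ) :
    nonpivotSpan v p x ≤ aliveSpan v x :=
  Submodule.span_mono (Set.image_mono fun _ h => h.1)

theorem nonpivotSpan_eq_aliveSpan (v : ι → E) {p : ι} {x : ι → ℝ} (hp : ¬ |x p| < 1) :
    nonpivotSpan v p x = aliveSpan v x := by
  unfold nonpivotSpan aliveSpan
  congr 2
  ext j
  exact ⟨fun h => h.1, fun h => ⟨h, fun e => hp (e ▸ h)⟩⟩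

theorem nonpivotSpan_mono (v : ι → E) (p : ι) {x y : ι → ℝ} (h : ∀ j, |y j| < 1 → |x j| < 1) :
    nonpivotSpan v p y ≤ nonpivotSpan v p x :=
  Submodule.span_mono (Set.image_mono fun j hj => ⟨h j hj.1, hj.2⟩)

theorem aliveSpan_mono (v : ι → E) {x y : ι → ℝ} (h : ∀ j, |y j| < 1 → |x j| < 1) :
    aliveSpan v y ≤ aliveSpan v x :=
  Submodule.span_mono (Set.image_mono fun j hj => h j hj)

variable [Fintype ι]

/-- `u` is an admissible direction of the walk at `x` with pivot `p`: it has pivot entry `1`,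
moves alive coordinates only, and `∑ j, u j • v j` is orthogonal to the vectors of the alive
coordinates other than `p`. -/
structure IsWalkDirection (v : ι → E) (p : ι) (x u : ι → ℝ) : Prop where
  pivot : u p = 1
  frozen : ∀ j, ¬ |x j| < 1 → u j = 0
  orthogonal : ∀ y ∈ nonpivotSpan v p x, inner ℝ (∑ j, u j • v j) y = 0

/-- A potential of the walk: `Φ p x` for a position `x` with pivot `p`, and `Ψ x` for a position
whose pivot has still to be chosen. Along every admissible direction `Φ` lies below an affine
function that it touches at the current position, so a mean-zero step does not increase it on
average; neither do the choice of a pivot and the release of a frozen one. -/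
structure IsWalkPotential (v : ι → E) (Φ : ι → (ι → ℝ) → ℝ) (Ψ : (ι → ℝ) → ℝ) : Prop where
  choose_pivot : ∀ p x, (∀ j, |x j| ≤ 1) → |x p| < 1 → Φ p x ≤ Ψ x
  release_pivot : ∀ p x, (∀ j, |x j| ≤ 1) → ¬ |x p| < 1 → Ψ x ≤ Φ p x
  step : ∀ p x u, (∀ j, |x j| ≤ 1) → |x p| < 1 → IsWalkDirection v p x u →
    ∃ L : ℝ, ∀ δ : ℝ, (∀ j, |x j + δ * u j| ≤ 1) → Φ p (x + δ • u) ≤ Φ p x + L * δ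

theorem IsWalkDirection.alive_of_alive {v : ι → E} {p : ι} {x u : ι → ℝ}
    (hu : IsWalkDirection v p x u) (δ : ℝ) (j : ι)
    (h : |(x + δ • u) j| < 1) : |x j| < 1 := by
  by_contra h'
  simp [hu.frozen j h'] at h
  exact h' h

theorem exists_isWalkDirection (v : ι → E) {p : ι} {x : ι → ℝ} (hp : |x p| < 1) :
    ∃ u, IsWalkDirection v p x u := by
  classical
  have : FiniteDimensional ℝ (nonpivotSpan v p x) :=
    FiniteDimensional.span_of_finite ℝ (Set.toFinite _)
  set W := nonpivotSpan v p x with hW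
  have hset : {j | |x j| < 1 ∧ j ≠ p}
      = ((Finset.univ.filter fun j => |x j| < 1 ∧ j ≠ p : Finset ι) : Set ι) := by simp
  have hmem : W.starProjection (v p) ∈ Submodule.span ℝ (v '' {j | |x j| < 1 ∧ j ≠ p}) :=
    Submodule.starProjection_apply_mem W (v p)
  rw [hset] at hmem
  obtain ⟨c, hc⟩ := (Submodule.mem_span_image_finset_iff_exists_fun' ℝ).1 hmem
  have hsum : ∑ j, (if j = p then 1 else if |x j| < 1 then -c j else 0) • v j
      = v p - W.starProjection (v p) := by
    rw [← hc, Finset.sum_filter, ← Finset.add_sum_erase _ _ (Finset.mem_univ p),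
      ← Finset.add_sum_erase (a := p) (f := fun a => if |x a| < 1 ∧ a ≠ p then c a • v a else 0)
        _ (Finset.mem_univ p), sub_eq_add_neg, neg_add, ← Finset.sum_neg_distrib]
    simp only [if_true, one_smul, ne_eq, not_true_eq_false, and_false, if_false, neg_zero, zero_add]
    congr 1
    refine Finset.sum_congr rfl fun j hj => ?_
    have hjp : j ≠ p := Finset.ne_of_mem_erase hj
    by_cases h : |x j| < 1 <;> simp [hjp, h]
  refine ⟨fun j => if j = p then 1 else if |x j| < 1 then -c j else 0, by simp, fun j hj => ?_, ?_⟩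
  · have hjp : j ≠ p := fun e => hj (e ▸ hp)
    simp [hjp, hj]
  · intro y hy
    rw [hsum]
    exact Submodule.starProjection_inner_eq_zero _ _ hy

/-- From a point of the cube one can move along `u` until an alive coordinate freezes. -/
theorem exists_step_freezing {x u : ι → ℝ} (hx : ∀ j, |x j| ≤ 1) {p : ι} (hup : u p ≠ 0)
    (hu : ∀ j, ¬ |x j| < 1 → u j = 0) :
    ∃ δ : ℝ, 0 < δ ∧ (∀ j, |x j + δ * u j| ≤ 1) ∧ ∃ j, |x j| < 1 ∧ ¬ |x j + δ * u j| < 1 := by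
  classical
  -- `r j` is the time at which coordinate `j` reaches `1` or `-1`.
  let r : ι → ℝ := fun j => (|u j| - x j * u j) / u j ^ 2
  obtain ⟨k, hk, hmin⟩ := (Finset.univ.filter fun j => u j ≠ 0).exists_min_image r
    ⟨p, by simpa using hup⟩
  have hk0 : u k ≠ 0 := by simpa using hk
  have halive : ∀ j, u j ≠ 0 → |x j| < 1 := fun j hj => by
    by_contra h
    exact hj (hu j h)
  have hr : ∀ j, u j ≠ 0 → 0 < r j := fun j hj => by
    refine div_pos ?_ (by positivity)
    have h1 : x j * u j ≤ |x j| * |u j| := by rw [← abs_mul]; exact le_abs_self _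
    nlinarith [halive j hj, abs_pos.2 hj]
  have hru : ∀ j, u j ≠ 0 → r j * |u j| ^ 2 = |u j| - x j * u j := fun j hj => by
    rw [sq_abs]
    exact div_mul_cancel₀ _ (by positivity)
  refine ⟨r k, hr k hk0, fun j => ?_, k, halive k hk0, ?_⟩
  · by_cases hj : u j = 0
    · simpa [hj] using hx j
    have h1 : r k ≤ r j := hmin j (by simpa using hj)
    have h2 := hru j hj
    have h3 := hr k hk0
    have h4 := halive j hj
    rcases abs_cases (u j) with ⟨e, he⟩ | ⟨e, he⟩ <;> rw [e] at h2 <;>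
      rw [abs_lt] at h4 <;> rw [abs_le]
    · have hpos : 0 < u j := lt_of_le_of_ne he (Ne.symm hj)
      have h5 : r j * u j = 1 - x j := by
        apply mul_right_cancel₀ hj
        linarith
      constructor <;> nlinarith
    · have h5 : r j * u j = -1 - x j := by
        apply mul_right_cancel₀ hj
        linarith
      constructor <;> nlinarith
  · have h2 := hru k hk0
    rcases abs_cases (u k) with ⟨e, he⟩ | ⟨e, he⟩ <;> rw [e] at h2
    · have h5 : r k * u k = 1 - x k := by
        apply mul_right_cancel₀ hk0
        linarith
      simp [h5]
    · have h5 : r k * u k = -1 - x k := by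
        apply mul_right_cancel₀ hk0
        linarith
      simp [h5]

open Classical in
/-- The number of alive coordinates. -/
noncomputable def aliveCard (x : ι → ℝ) : ℕ := (Finset.univ.filter fun j => |x j| < 1).card

theorem aliveCard_lt {x u : ι → ℝ} (hu : ∀ j, ¬ |x j| < 1 → u j = 0) {δ : ℝ} {j : ι}
    (hj : |x j| < 1) (hj' : ¬ |x j + δ * u j| < 1) : aliveCard (x + δ • u) < aliveCard x := by
  classical
  refine Finset.card_lt_card (Finset.ssubset_iff_of_subset ?_ |>.2 ⟨j, by simpa using hj, ?_⟩)
  · intro i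
    simp only [Finset.mem_filter, Finset.mem_univ, true_and, Pi.add_apply, Pi.smul_apply,
      smul_eq_mul]
    intro h
    by_contra h'
    rw [hu i h', mul_zero, add_zero] at h
    exact h' h
  · simpa using hj'

/-- The Gram–Schmidt walk: from every point of the cube there is a probability distribution on
sign vectors under which the expectation of each potential is at most its initial value. -/
theorem exists_sign_distribution [DecidableEq ι] (v : ι → E) (x : ι → ℝ) (hx : ∀ j, |x j| ≤ 1) :
    ∃ μ : (ι → ℤˣ) → ℝ, (∀ s, 0 ≤ μ s) ∧ ∑ s, μ s = 1 ∧
      ∀ Φ Ψ, IsWalkPotential v Φ Ψ →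
        ∑ s, μ s * Ψ (fun j => ((s j : ℤ) : ℝ)) ≤ Ψ x := by
  suffices H : ∀ N : ℕ, ∀ x : ι → ℝ, (∀ j, |x j| ≤ 1) → aliveCard x = N →
      (∀ p, |x p| < 1 → ∃ μ : (ι → ℤˣ) → ℝ, (∀ s, 0 ≤ μ s) ∧ ∑ s, μ s = 1 ∧
        ∀ Φ Ψ, IsWalkPotential v Φ Ψ → ∑ s, μ s * Ψ (fun j => ((s j : ℤ) : ℝ)) ≤ Φ p x) ∧
      ∃ μ : (ι → ℤˣ) → ℝ, (∀ s, 0 ≤ μ s) ∧ ∑ s, μ s = 1 ∧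
        ∀ Φ Ψ, IsWalkPotential v Φ Ψ → ∑ s, μ s * Ψ (fun j => ((s j : ℤ) : ℝ)) ≤ Ψ x from
    (H _ x hx rfl).2
  intro N
  induction N using Nat.strong_induction_on with
  | _ N ih =>
  intro x hx hN
  have hpivot : ∀ p, |x p| < 1 → ∃ μ : (ι → ℤˣ) → ℝ, (∀ s, 0 ≤ μ s) ∧ ∑ s, μ s = 1 ∧
      ∀ Φ Ψ, IsWalkPotential v Φ Ψ → ∑ s, μ s * Ψ (fun j => ((s j : ℤ) : ℝ)) ≤ Φ p x := by
    intro p hp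
    obtain ⟨u, hu⟩ := exists_isWalkDirection v hp
    have hmove : ∀ δ : ℝ, (∀ j, |x j + δ * u j| ≤ 1) →
        (∃ j, |x j| < 1 ∧ ¬ |x j + δ * u j| < 1) →
        ∃ μ : (ι → ℤˣ) → ℝ, (∀ s, 0 ≤ μ s) ∧ ∑ s, μ s = 1 ∧
          ∀ Φ Ψ, IsWalkPotential v Φ Ψ →
            ∑ s, μ s * Ψ (fun j => ((s j : ℤ) : ℝ)) ≤ Φ p (x + δ • u) := by
      rintro δ hδ ⟨j, hj, hj'⟩
      have hy : ∀ j, |(x + δ • u) j| ≤ 1 := hδ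
      obtain ⟨h1, h2⟩ := ih _ (hN ▸ aliveCard_lt hu.frozen hj hj') (x + δ • u) hy rfl
      by_cases hpy : |(x + δ • u) p| < 1
      · exact h1 p hpy
      · obtain ⟨μ, h0, hs, h⟩ := h2
        exact ⟨μ, h0, hs, fun Φ Ψ hΦ => (h Φ Ψ hΦ).trans (hΦ.release_pivot p _ hy hpy)⟩
    obtain ⟨s, hs0, hs, hs'⟩ := exists_step_freezing hx (by simp [hu.pivot] : u p ≠ 0) hu.frozen
    obtain ⟨t, ht0, ht, ht'⟩ := exists_step_freezing (u := -u) hx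
      (by simp [hu.pivot] : (-u) p ≠ 0) (fun j hj => by simp [hu.frozen j hj])
    obtain ⟨μ, hμ0, hμ1, hμ⟩ := hmove s hs hs'
    obtain ⟨ν, hν0, hν1, hν⟩ := hmove (-t) (by simpa using ht) (by simpa using ht')
    -- The step is `s` or `-t`, with the probabilities that give it mean zero.
    refine ⟨fun σ => t / (s + t) * μ σ + s / (s + t) * ν σ, fun σ => ?_, ?_, fun Φ Ψ hΦ => ?_⟩
    · have := hμ0 σ
      have := hν0 σ
      positivity
    · rw [Finset.sum_add_distrib, ← Finset.mul_sum, ← Finset.mul_sum, hμ1, hν1]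
      field_simp
      ring
    · obtain ⟨L, hL⟩ := hΦ.step p x u hx hp hu
      have h1 := (hμ Φ Ψ hΦ).trans (hL s hs)
      have h2 := (hν Φ Ψ hΦ).trans (hL (-t) (by simpa using ht))
      simp only [add_mul, mul_assoc]
      rw [Finset.sum_add_distrib, ← Finset.mul_sum, ← Finset.mul_sum]
      calc _ ≤ t / (s + t) * (Φ p x + L * s) + s / (s + t) * (Φ p x + L * -t) := by gcongr
        _ = Φ p x := by field_simp; ring
  refine ⟨hpivot, ?_⟩
  by_cases hex : ∃ p, |x p| < 1
  · obtain ⟨p, hp⟩ := hex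
    obtain ⟨μ, h0, h1, h⟩ := hpivot p hp
    exact ⟨μ, h0, h1, fun Φ Ψ hΦ => (h Φ Ψ hΦ).trans (hΦ.choose_pivot p x hx hp)⟩
  · push Not at hex
    have hsign : ∀ j, ∃ s : ℤˣ, ((s : ℤ) : ℝ) = x j := fun j => by
      rcases eq_or_eq_neg_of_abs_eq (le_antisymm (hx j) (hex j)) with h | h
      · exact ⟨1, by simp [h]⟩
      · exact ⟨-1, by simp [h]⟩
    choose s hs using hsign
    refine ⟨Pi.single s 1, fun σ => ?_, by simp, fun Φ Ψ hΦ => ?_⟩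
    · by_cases h : σ = s
      · simp [h]
      · simp [h]
    · simp [Pi.single_apply, hs]

end Walk

/-! ### The pivot residual and the energy of a test vector -/

section Geometry

variable {ι E : Type*} [NormedAddCommGroup E] [InnerProductSpace ℝ E] [FiniteDimensional ℝ E]
  {v : ι → E} {p : ι} {x u : ι → ℝ}

/-- The component of the pivot vector orthogonal to the other alive vectors. -/
noncomputable def pivotResidual (v : ι → E) (p : ι) (x : ι → ℝ) : E :=
  v p - (nonpivotSpan v p x).starProjection (v p)

theorem inner_pivotResidual_eq_zero (v : ι → E) (p : ι) (x : ι → ℝ) {y : E}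
    (hy : y ∈ nonpivotSpan v p x) : inner ℝ (pivotResidual v p x) y = 0 :=
  Submodule.starProjection_inner_eq_zero _ _ hy

theorem pivotResidual_mem_aliveSpan (v : ι → E) (hp : |x p| < 1) :
    pivotResidual v p x ∈ aliveSpan v x :=
  sub_mem (Submodule.subset_span ⟨p, hp, rfl⟩)
    (nonpivotSpan_le_aliveSpan v p x (Submodule.starProjection_apply_mem _ _))

theorem norm_pivotResidual_sq (v : ι → E) (p : ι) (x : ι → ℝ) :
    ‖pivotResidual v p x‖ ^ 2
      = ‖v p‖ ^ 2 - ‖(nonpivotSpan v p x).starProjection (v p)‖ ^ 2 := by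
  have h := norm_starProjection_sub_sq_of_le (W := nonpivotSpan v p x) (Z := ⊤) le_top (v p)
  rwa [Submodule.starProjection_eq_self_iff.2 (Submodule.mem_top (x := v p))] at h

theorem norm_pivotResidual_sq_le_one (hv : ‖v p‖ ≤ 1) (x : ι → ℝ) :
    ‖pivotResidual v p x‖ ^ 2 ≤ 1 := by
  rw [norm_pivotResidual_sq]
  nlinarith [norm_nonneg (v p), sq_nonneg ‖(nonpivotSpan v p x).starProjection (v p)‖]

/-- The squared length of the projection of `θ` onto the alive vectors other than the pivot. -/
noncomputable def nonpivotEnergy (v : ι → E) (θ : E) (p : ι) (x : ι → ℝ) : ℝ :=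
  ‖(nonpivotSpan v p x).starProjection θ‖ ^ 2

/-- The squared length of the projection of `θ` onto the alive vectors. -/
noncomputable def aliveEnergy (v : ι → E) (θ : E) (x : ι → ℝ) : ℝ :=
  ‖(aliveSpan v x).starProjection θ‖ ^ 2

theorem nonpivotEnergy_le_aliveEnergy (v : ι → E) (θ : E) (p : ι) (x : ι → ℝ) :
    nonpivotEnergy v θ p x ≤ aliveEnergy v θ x :=
  norm_starProjection_sq_mono (nonpivotSpan_le_aliveSpan v p x) θ

theorem nonpivotEnergy_eq_aliveEnergy (θ : E) (hp : ¬ |x p| < 1) :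
    nonpivotEnergy v θ p x = aliveEnergy v θ x := by
  simp only [nonpivotEnergy, aliveEnergy, nonpivotSpan_eq_aliveSpan v hp]

theorem aliveEnergy_le (v : ι → E) (θ : E) (x : ι → ℝ) : aliveEnergy v θ x ≤ ‖θ‖ ^ 2 :=
  pow_le_pow_left₀ (norm_nonneg _) (Submodule.norm_starProjection_apply_le _ _) 2

theorem inner_pivotResidual_sq_le (hv : ‖v p‖ ≤ 1) (hp : |x p| < 1) (θ : E) :
    inner ℝ (pivotResidual v p x) θ ^ 2 ≤ aliveEnergy v θ x - nonpivotEnergy v θ p x := by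
  refine (inner_sq_le_of_mem_of_orthogonal (nonpivotSpan_le_aliveSpan v p x)
    (pivotResidual_mem_aliveSpan v hp) (fun y => inner_pivotResidual_eq_zero v p x) θ).trans ?_
  exact mul_le_of_le_one_left (sub_nonneg.2 (nonpivotEnergy_le_aliveEnergy v θ p x))
    (norm_pivotResidual_sq_le_one hv x)

theorem nonpivotEnergy_mono {y : ι → ℝ} (h : ∀ j, |y j| < 1 → |x j| < 1) (θ : E) :
    nonpivotEnergy v θ p y ≤ nonpivotEnergy v θ p x :=
  norm_starProjection_sq_mono (nonpivotSpan_mono v p h) θ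

theorem aliveEnergy_mono {y : ι → ℝ} (h : ∀ j, |y j| < 1 → |x j| < 1) (θ : E) :
    aliveEnergy v θ y ≤ aliveEnergy v θ x :=
  norm_starProjection_sq_mono (aliveSpan_mono v h) θ

/-- When coordinates freeze, the change of `⟪pivotResidual, θ⟫` is paid for by the growth of the
residual and by the loss of nonpivot energy. -/
theorem two_mul_abs_inner_pivotResidual_sub_le
    {y : ι → ℝ} (h : ∀ j, |y j| < 1 → |x j| < 1) (θ : E) :
    2 * |inner ℝ (pivotResidual v p y) θ - inner ℝ (pivotResidual v p x) θ|
      ≤ (‖pivotResidual v p y‖ ^ 2 - ‖pivotResidual v p x‖ ^ 2)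
        + (nonpivotEnergy v θ p x - nonpivotEnergy v θ p y) := by
  have hle := nonpivotSpan_mono v p h
  set W := nonpivotSpan v p x with hW
  set W' := nonpivotSpan v p y with hW'
  have hc : pivotResidual v p y - pivotResidual v p x
      = W.starProjection (v p) - W'.starProjection (v p) := by
    simp only [pivotResidual, ← hW, ← hW']
    abel
  have hγ : ‖W.starProjection (v p) - W'.starProjection (v p)‖ ^ 2
      = ‖pivotResidual v p y‖ ^ 2 - ‖pivotResidual v p x‖ ^ 2 := by
    rw [norm_starProjection_sub_sq_of_le hle, norm_pivotResidual_sq, norm_pivotResidual_sq]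
    ring
  have hmem : W.starProjection (v p) - W'.starProjection (v p) ∈ W :=
    sub_mem (Submodule.starProjection_apply_mem _ _) (hle (Submodule.starProjection_apply_mem _ _))
  have horth : ∀ z ∈ W', inner ℝ (W.starProjection (v p) - W'.starProjection (v p)) z = 0 := by
    intro z hz
    rw [← hc, inner_sub_left, inner_pivotResidual_eq_zero v p y hz,
      inner_pivotResidual_eq_zero v p x (hle hz), sub_zero]
  have key := inner_sq_le_of_mem_of_orthogonal hle hmem horth θ
  rw [hγ, ← hc, inner_sub_left] at key
  change _ ≤ _ * (nonpivotEnergy v θ p x - nonpivotEnergy v θ p y) at key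
  have h1 : 0 ≤ ‖pivotResidual v p y‖ ^ 2 - ‖pivotResidual v p x‖ ^ 2 := hγ ▸ sq_nonneg _
  have h2 := sub_nonneg.2 (nonpivotEnergy_mono (v := v) (p := p) h θ)
  refine abs_le_of_sq_le_sq' (a := 2 * |_|) ?_ (add_nonneg h1 h2) |>.2
  rw [mul_pow, sq_abs]
  nlinarith [sq_nonneg ((‖pivotResidual v p y‖ ^ 2 - ‖pivotResidual v p x‖ ^ 2)
    - (nonpivotEnergy v θ p x - nonpivotEnergy v θ p y))]

variable [Fintype ι]

theorem IsWalkDirection.sum_eq_pivotResidual (hu : IsWalkDirection v p x u) :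
    ∑ j, u j • v j = pivotResidual v p x := by
  classical
  have hmem : v p - ∑ j, u j • v j ∈ nonpivotSpan v p x := by
    rw [← Finset.add_sum_erase _ _ (Finset.mem_univ p), hu.pivot, one_smul, sub_add_cancel_left]
    refine neg_mem (sum_mem fun j hj => ?_)
    by_cases h : |x j| < 1
    · exact Submodule.smul_mem _ _
        (Submodule.subset_span ⟨j, ⟨h, Finset.ne_of_mem_erase hj⟩, rfl⟩)
    · simp [hu.frozen j h]
  have := Submodule.eq_starProjection_of_mem_of_inner_eq_zero (u := v p) hmem
    (by simpa only [sub_sub_cancel] using hu.orthogonal)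
  rw [pivotResidual, this, sub_sub_cancel]

theorem IsWalkDirection.inner_sum_add_smul (hu : IsWalkDirection v p x u) (θ : E) (δ : ℝ) :
    inner ℝ (∑ j, (x + δ • u) j • v j) θ
      = inner ℝ (∑ j, x j • v j) θ + δ * inner ℝ (pivotResidual v p x) θ := by
  rw [← hu.sum_eq_pivotResidual, ← real_inner_smul_left, ← inner_add_left, Finset.smul_sum,
    ← Finset.sum_add_distrib]
  simp [add_smul, mul_smul]

/-! ### The covariance potential -/

/-- The potential behind the bound `E ⟪∑ j, X j • v j, θ⟫² ≤ ‖θ‖²` for the final signs `X`. -/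
theorem isWalkPotential_covariance (hv : ∀ j, ‖v j‖ ≤ 1) (θ : E) :
    IsWalkPotential v
      (fun p x => inner ℝ (∑ j, x j • v j) θ ^ 2 + (nonpivotEnergy v θ p x
        + (1 - x p ^ 2) * (aliveEnergy v θ x - nonpivotEnergy v θ p x)))
      (fun x => inner ℝ (∑ j, x j • v j) θ ^ 2 + aliveEnergy v θ x) where
  choose_pivot p x hx hp := by
    nlinarith [nonpivotEnergy_le_aliveEnergy v θ p x, sq_nonneg (x p)]
  release_pivot p x hx hp := by
    rw [nonpivotEnergy_eq_aliveEnergy θ hp]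
    simp
  step p x u hx hp hu := by
    set T := inner ℝ (∑ j, x j • v j) θ
    set a := inner ℝ (pivotResidual v p x) θ with ha
    refine ⟨2 * T * a - 2 * x p * (aliveEnergy v θ x - nonpivotEnergy v θ p x), fun δ hδ => ?_⟩
    have hal := hu.alive_of_alive δ
    have h1 := nonpivotEnergy_mono (p := p) (v := v) hal θ
    have h2 := aliveEnergy_mono (v := v) hal θ
    have h3 := inner_pivotResidual_sq_le (hv p) hp θ
    rw [← ha] at h3
    have h4 := hδ p
    rw [hu.inner_sum_add_smul, ← ha]
    simp only [Pi.add_apply, Pi.smul_apply, smul_eq_mul, hu.pivot, mul_one] at h4 ⊢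
    have h5 : (x p + δ) ^ 2 ≤ 1 := (sq_le_one_iff_abs_le_one _).2 h4
    nlinarith [mul_le_mul_of_nonneg_left h1 (sq_nonneg (x p + δ)),
      mul_le_mul_of_nonneg_left h2 (sub_nonneg.2 h5),
      mul_le_mul_of_nonneg_left h3 (sq_nonneg δ)]

end Geometry

/-! ### The exponential potential -/

section Exponential

theorem exp_mul_one_add_le {a q x δ : ℝ} (ha : a ^ 2 ≤ q) (hq : q ≤ 1 / 256) (hx : |x| ≤ 1)
    (hxδ : |x + δ| ≤ 1) :
    Real.exp (δ * a) * (1 + 2 * ((1 - (x + δ) ^ 2) * q))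
      ≤ 1 + 2 * ((1 - x ^ 2) * q) + (a * (1 + 2 * ((1 - x ^ 2) * q)) - 4 * x * q) * δ := by
  have hq0 : 0 ≤ q := (sq_nonneg a).trans ha
  have ha' : |a| ≤ 1 / 16 := abs_le_of_sq_le_sq (by linarith) (by norm_num)
  have hδ : |δ| ≤ 2 := by
    rw [abs_le] at *
    constructor <;> linarith
  have hy : |δ * a| ≤ 1 / 8 := by
    rw [abs_mul]
    nlinarith [abs_nonneg δ, abs_nonneg a]
  have hexp : Real.exp (δ * a) ≤ 1 + δ * a + (δ * a) ^ 2 := by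
    have := (abs_le.1 (Real.abs_exp_sub_one_sub_id_le (hy.trans (by norm_num)))).2
    linarith
  have hx2 : x ^ 2 ≤ 1 := (sq_le_one_iff_abs_le_one _).2 hx
  have hS : 0 ≤ 1 + 2 * ((1 - (x + δ) ^ 2) * q) := by
    have := mul_nonneg (sub_nonneg.2 ((sq_le_one_iff_abs_le_one _).2 hxδ)) hq0
    linarith
  refine (mul_le_mul_of_nonneg_right hexp hS).trans ?_
  -- The second-order terms, divided by `δ ^ 2`; the last one, `-2 * q`, dominates.
  have hrest : a ^ 2 * (1 + 2 * ((1 - x ^ 2) * q)) - 4 * (x * a) * q - 4 * (x * δ) * q * a ^ 2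
      - 2 * q * (δ * a) - 2 * q * (δ * a) ^ 2 - 2 * q ≤ 0 := by
    have e1 : a ^ 2 * (1 + 2 * ((1 - x ^ 2) * q)) ≤ q * (1 + 2 / 256) := by
      refine mul_le_mul ha ?_ ?_ hq0
      · nlinarith [mul_nonneg (sq_nonneg x) hq0]
      · nlinarith [mul_nonneg (sub_nonneg.2 hx2) hq0]
    have e2 : -(x * a) ≤ 1 / 16 := by
      refine (neg_le_abs _).trans ?_
      rw [abs_mul]
      nlinarith [abs_nonneg x, abs_nonneg a]
    have e3 : -(x * δ) ≤ 2 := by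
      refine (neg_le_abs _).trans ?_
      rw [abs_mul]
      nlinarith [abs_nonneg x, abs_nonneg δ]
    have e4 := (abs_le.1 hy).1
    have e5 : -(x * δ) * (q * a ^ 2) ≤ 2 * (q * (1 / 256)) :=
      mul_le_mul e3 (mul_le_mul_of_nonneg_left (ha.trans hq) hq0) (by positivity) (by norm_num)
    nlinarith [mul_le_mul_of_nonneg_left e2 hq0, mul_le_mul_of_nonneg_left e4 hq0,
      mul_nonneg hq0 (sq_nonneg (δ * a))]
  have := mul_nonneg_of_nonpos_of_nonpos hrest (neg_nonpos.2 (sq_nonneg δ))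
  linear_combination this

theorem exp_energy_mono {w w' q q' k : ℝ} (hq : 0 ≤ q) (hq' : 0 ≤ q') (hw : w' ≤ w)
    (hz : w' + q' ≤ w + q) (hk0 : 0 ≤ k) (hk1 : k ≤ 1) :
    Real.exp (290 * w' + 288 * q') * (1 + 2 * (k * q'))
      ≤ Real.exp (290 * w + 288 * q) * (1 + 2 * (k * q)) := by
  rcases le_total q' q with h | h
  · gcongr
  · have h1 : 1 + 2 * (k * q') ≤ (1 + 2 * (k * q)) * Real.exp (2 * (q' - q)) := by
      have h2 := Real.add_one_le_exp (2 * (q' - q))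
      have h3 : 0 ≤ k * q := mul_nonneg hk0 hq
      refine le_trans ?_ (mul_le_mul_of_nonneg_left h2 (by positivity))
      nlinarith [mul_nonneg h3 (sub_nonneg.2 h), mul_nonneg (sub_nonneg.2 hk1) (sub_nonneg.2 h)]
    calc _ ≤ Real.exp (290 * w' + 288 * q')
          * ((1 + 2 * (k * q)) * Real.exp (2 * (q' - q))) := by gcongr
      _ = Real.exp (290 * w' + 288 * q' + 2 * (q' - q)) * (1 + 2 * (k * q)) := by
        rw [Real.exp_add (290 * w' + 288 * q')]
        ring
      _ ≤ _ := by
        gcongr ?_ * _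
        exact Real.exp_le_exp.2 (by linarith)

variable {ι E : Type*} [NormedAddCommGroup E] [InnerProductSpace ℝ E] [FiniteDimensional ℝ E]
  [Fintype ι] {v : ι → E}

/-- The branch of the exponential potential that serves while the energy of `θ` along the pivot
residual is small: the second factor is concave enough in the pivot coordinate to compensate the
convexity of the exponential. This needs an energy of at most `1 / 256`; the coefficient `288` makes
`largePotential` the smaller branch beyond that threshold, and `290 = 288 + 2` absorbs the growth of
the second factor when energy moves from the nonpivot span to the residual. -/
noncomputable def smallPotential (v : ι → E) (θ : E) (p : ι) (x : ι → ℝ) : ℝ :=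
  Real.exp (inner ℝ (∑ j, x j • v j) θ)
    * (Real.exp (290 * nonpivotEnergy v θ p x
        + 288 * (aliveEnergy v θ x - nonpivotEnergy v θ p x))
      * (1 + 2 * ((1 - x p ^ 2) * (aliveEnergy v θ x - nonpivotEnergy v θ p x))))

/-- The branch of the exponential potential that serves while the energy of `θ` along the pivot
residual is large: the summand `-x p * ⟪pivotResidual, θ⟫` makes it constant along the step, up to
the freezing of coordinates. -/
noncomputable def largePotential (v : ι → E) (θ : E) (p : ι) (x : ι → ℝ) : ℝ :=
  Real.exp (inner ℝ (∑ j, x j • v j) θ + 290 * nonpivotEnergy v θ p x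
    + |inner ℝ (pivotResidual v p x) θ| - x p * inner ℝ (pivotResidual v p x) θ
    + (1 - ‖pivotResidual v p x‖ ^ 2))

theorem largePotential_le_smallPotential {p : ι} {x : ι → ℝ} (hv : ‖v p‖ ≤ 1) (θ : E)
    (hp : |x p| < 1) (hq : 1 / 256 ≤ aliveEnergy v θ x - nonpivotEnergy v θ p x) :
    largePotential v θ p x ≤ smallPotential v θ p x := by
  unfold largePotential smallPotential
  have ha := inner_pivotResidual_sq_le hv hp θ
  set a := inner ℝ (pivotResidual v p x) θ
  set q := aliveEnergy v θ x - nonpivotEnergy v θ p x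
  have ha' : |a| ≤ 16 * q := abs_le_of_sq_le_sq (by nlinarith) (by linarith)
  have hxa : -(x p * a) ≤ |a| := by
    refine (neg_le_abs _).trans ?_
    rw [abs_mul]
    exact mul_le_of_le_one_left (abs_nonneg a) hp.le
  have hx2 : x p ^ 2 ≤ 1 := (sq_le_one_iff_abs_le_one _).2 hp.le
  have h1 : 1 ≤ 1 + 2 * ((1 - x p ^ 2) * q) := by
    have := mul_nonneg (sub_nonneg.2 hx2) (by linarith : 0 ≤ q)
    linarith
  rw [← mul_assoc, ← Real.exp_add]
  refine le_trans (Real.exp_le_exp.2 ?_) (le_mul_of_one_le_right (Real.exp_pos _).le h1)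
  nlinarith [sq_nonneg ‖pivotResidual v p x‖]

theorem largePotential_step {p : ι} {x u : ι → ℝ} (hu : IsWalkDirection v p x u) (θ : E) {δ : ℝ}
    (hδ : ∀ j, |x j + δ * u j| ≤ 1) :
    largePotential v θ p (x + δ • u) ≤ largePotential v θ p x := by
  unfold largePotential
  have hal := hu.alive_of_alive δ
  have h1 := nonpivotEnergy_mono (p := p) (v := v) hal θ
  have h2 := two_mul_abs_inner_pivotResidual_sub_le (p := p) (v := v) hal θ
  rw [hu.inner_sum_add_smul]
  have h3 := hδ p
  simp only [Pi.add_apply, Pi.smul_apply, smul_eq_mul, hu.pivot, mul_one] at h3 ⊢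
  set a := inner ℝ (pivotResidual v p x) θ
  set a' := inner ℝ (pivotResidual v p (x + δ • u)) θ
  refine Real.exp_le_exp.2 ?_
  have h4 : |a'| ≤ |a| + |a' - a| := by
    have := abs_add_le a (a' - a)
    rwa [add_sub_cancel] at this
  have h5 : -((x p + δ) * (a' - a)) ≤ |a' - a| := by
    refine (neg_le_abs _).trans ?_
    rw [abs_mul]
    exact mul_le_of_le_one_left (abs_nonneg _) h3
  linarith

theorem smallPotential_step {p : ι} {x u : ι → ℝ} (hv : ‖v p‖ ≤ 1) (hp : |x p| < 1)
    (hu : IsWalkDirection v p x u) (θ : E)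
    (hq : aliveEnergy v θ x - nonpivotEnergy v θ p x ≤ 1 / 256) :
    ∃ L : ℝ, ∀ δ : ℝ, (∀ j, |x j + δ * u j| ≤ 1) →
      smallPotential v θ p (x + δ • u) ≤ smallPotential v θ p x + L * δ := by
  have ha := inner_pivotResidual_sq_le hv hp θ
  refine ⟨Real.exp (inner ℝ (∑ j, x j • v j) θ) * Real.exp (290 * nonpivotEnergy v θ p x
        + 288 * (aliveEnergy v θ x - nonpivotEnergy v θ p x)) *
      (inner ℝ (pivotResidual v p x) θ * (1 + 2 * ((1 - x p ^ 2)
        * (aliveEnergy v θ x - nonpivotEnergy v θ p x)))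
        - 4 * x p * (aliveEnergy v θ x - nonpivotEnergy v θ p x)), fun δ hδ => ?_⟩
  unfold smallPotential
  have hal := hu.alive_of_alive δ
  have h1 := nonpivotEnergy_mono (p := p) (v := v) hal θ
  have h2 := aliveEnergy_mono (v := v) hal θ
  have h0 := nonpivotEnergy_le_aliveEnergy v θ p x
  have h0' := nonpivotEnergy_le_aliveEnergy v θ p (x + δ • u)
  rw [hu.inner_sum_add_smul]
  have h3 := hδ p
  simp only [Pi.add_apply, Pi.smul_apply, smul_eq_mul, hu.pivot, mul_one] at h3 ⊢
  have h4 : (x p + δ) ^ 2 ≤ 1 := (sq_le_one_iff_abs_le_one _).2 h3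
  have key := exp_mul_one_add_le ha hq hp.le h3
  set a := inner ℝ (pivotResidual v p x) θ
  set T := inner ℝ (∑ j, x j • v j) θ
  set w := nonpivotEnergy v θ p x
  set q := aliveEnergy v θ x - w
  have hmono := exp_energy_mono (k := 1 - (x p + δ) ^ 2) (sub_nonneg.2 h0) (sub_nonneg.2 h0') h1
    (by linarith) (by linarith) (by linarith [sq_nonneg (x p + δ)])
  calc _ ≤ Real.exp (T + δ * a) * (Real.exp (290 * w + 288 * q)
        * (1 + 2 * ((1 - (x p + δ) ^ 2) * q))) :=
        mul_le_mul_of_nonneg_left hmono (Real.exp_pos _).le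
    _ = Real.exp T * Real.exp (290 * w + 288 * q)
        * (Real.exp (δ * a) * (1 + 2 * ((1 - (x p + δ) ^ 2) * q))) := by
        rw [Real.exp_add]
        ring
    _ ≤ Real.exp T * Real.exp (290 * w + 288 * q) * _ :=
        mul_le_mul_of_nonneg_left key (by positivity)
    _ = _ := by ring

/-- The potential behind the subgaussian bound for the final signs. -/
theorem isWalkPotential_exponential (hv : ∀ j, ‖v j‖ ≤ 1) (θ : E) :
    IsWalkPotential v (fun p x => min (largePotential v θ p x) (smallPotential v θ p x))
      (fun x => Real.exp (inner ℝ (∑ j, x j • v j) θ + 290 * aliveEnergy v θ x)) where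
  choose_pivot p x hx hp := by
    refine (min_le_right _ _).trans ?_
    have h0 := nonpivotEnergy_le_aliveEnergy v θ p x
    unfold smallPotential
    set w := nonpivotEnergy v θ p x
    set z := aliveEnergy v θ x
    have h1 : 1 + 2 * ((1 - x p ^ 2) * (z - w)) ≤ Real.exp (2 * (z - w)) := by
      have := Real.add_one_le_exp (2 * (z - w))
      nlinarith [mul_nonneg (sq_nonneg (x p)) (sub_nonneg.2 h0)]
    calc _ ≤ Real.exp (inner ℝ (∑ j, x j • v j) θ)
          * (Real.exp (290 * w + 288 * (z - w)) * Real.exp (2 * (z - w))) := by gcongr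
      _ = _ := by
        rw [← Real.exp_add, ← Real.exp_add]
        ring_nf
  release_pivot p x hx hp := by
    refine le_min (Real.exp_le_exp.2 ?_) ?_
    · rw [nonpivotEnergy_eq_aliveEnergy θ hp]
      have h1 := norm_pivotResidual_sq_le_one (hv p) x
      have h2 : x p * inner ℝ (pivotResidual v p x) θ ≤ |inner ℝ (pivotResidual v p x) θ| := by
        refine (le_abs_self _).trans ?_
        rw [abs_mul]
        exact mul_le_of_le_one_left (abs_nonneg _) (hx p)
      linarith
    · simp [smallPotential, nonpivotEnergy_eq_aliveEnergy θ hp, Real.exp_add]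
  step p x u hx hp hu := by
    rcases le_or_gt (largePotential v θ p x) (smallPotential v θ p x) with h | h
    · refine ⟨0, fun δ hδ => ?_⟩
      rw [min_eq_left h, zero_mul, add_zero]
      exact (min_le_left _ _).trans (largePotential_step hu θ hδ)
    · have hq : aliveEnergy v θ x - nonpivotEnergy v θ p x ≤ 1 / 256 := by
        by_contra hq
        exact h.not_ge (largePotential_le_smallPotential (hv p) θ hp (not_le.1 hq).le)
      obtain ⟨L, hL⟩ := smallPotential_step (hv p) hp hu θ hq
      refine ⟨L, fun δ hδ => ?_⟩
      rw [min_eq_right h.le]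
      exact (min_le_right _ _).trans (hL δ hδ)

/-- Vectors of norm at most `1` admit random signs whose signed sum has covariance at most the
identity and is subgaussian. -/
theorem exists_subgaussian_signs [DecidableEq ι] (hv : ∀ j, ‖v j‖ ≤ 1) :
    ∃ μ : (ι → ℤˣ) → ℝ, (∀ s, 0 ≤ μ s) ∧ ∑ s, μ s = 1 ∧
      (∀ θ, ∑ s, μ s * inner ℝ (∑ j, ((s j : ℤ) : ℝ) • v j) θ ^ 2 ≤ ‖θ‖ ^ 2) ∧
      ∀ θ, ∑ s, μ s * Real.exp (inner ℝ (∑ j, ((s j : ℤ) : ℝ) • v j) θ)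
        ≤ Real.exp (290 * ‖θ‖ ^ 2) := by
  obtain ⟨μ, h0, h1, h⟩ := exists_sign_distribution v 0 (by simp)
  refine ⟨μ, h0, h1, fun θ => ?_, fun θ => ?_⟩
  · have := h _ _ (isWalkPotential_covariance hv θ)
    refine (Finset.sum_le_sum fun s _ => mul_le_mul_of_nonneg_left ?_ (h0 s)).trans
      (this.trans ?_)
    · exact le_add_of_nonneg_right (sq_nonneg _)
    · simpa using aliveEnergy_le v θ 0
  · have := h _ _ (isWalkPotential_exponential hv θ)
    refine (Finset.sum_le_sum fun s _ => mul_le_mul_of_nonneg_left ?_ (h0 s)).trans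
      (this.trans ?_)
    · exact Real.exp_le_exp.2 (le_add_of_nonneg_right (mul_nonneg (by norm_num) (sq_nonneg _)))
    · simpa using aliveEnergy_le v θ 0

end Exponential

/-! ### Vector discrepancy and discrepancy of a matrix factored through vectors -/

section Discrepancy

/-- Finitely many vectors can be realised isometrically in a Euclidean space whose dimension is
their number. -/
theorem exists_euclidean_realization {ι H : Type*} [Fintype ι] [NormedAddCommGroup H]
    [InnerProductSpace ℝ H] (U : ι → H) :
    ∃ u : ι → EuclideanSpace ℝ ι, ∀ c : ι → ℝ, ‖∑ j, c j • u j‖ = ‖∑ j, c j • U j‖ := by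
  classical
  open scoped MatrixOrder Matrix.Norms.L2Operator in
  obtain ⟨B, hB⟩ := CStarAlgebra.nonneg_iff_eq_star_mul_self.1
    (Matrix.posSemidef_gram ℝ U).nonneg
  refine ⟨fun j => WithLp.toLp 2 (fun i => B i j), fun c => ?_⟩
  have hsum : ∑ j, c j • (WithLp.toLp 2 (fun i => B i j) : EuclideanSpace ℝ ι)
      = WithLp.toLp 2 (B *ᵥ c) := by
    ext i
    simp [Matrix.mulVec, dotProduct, mul_comm]
  rw [← sq_eq_sq₀ (norm_nonneg _) (norm_nonneg _), ← real_inner_self_eq_norm_sq (∑ j, c j • U j),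
    ← Matrix.star_dotProduct_gram_mulVec, hB, hsum, EuclideanSpace.real_norm_sq_eq,
    ← Matrix.mulVec_mulVec, Matrix.dotProduct_mulVec, Matrix.star_eq_conjTranspose,
    Matrix.conjTranspose_eq_transpose_of_trivial, Matrix.vecMul_transpose]
  simp [dotProduct, sq]

variable {m : ℕ} {ι : Type} [Fintype ι] {E : Type*} [NormedAddCommGroup E]
  [InnerProductSpace ℝ E] [FiniteDimensional ℝ E] {A : Matrix (Fin m) ι ℝ} {v : ι → E}
  {f : Fin m → E} {r : ℝ}

theorem vecdisc_le_of_factorization (hA : ∀ i j, A i j = inner ℝ (v j) (f i))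
    (hv : ∀ j, ‖v j‖ ≤ 1) (hr : 0 ≤ r) (hf : ∀ i, ‖f i‖ ≤ r) : HerDisc.vecdisc A ≤ r := by
  classical
  obtain ⟨μ, h0, h1, hcov, -⟩ := exists_subgaussian_signs hv
  -- The sign of `j`, as an element of `L²(μ)`; the factor `√(μ s)` turns it into a vector of the
  -- Euclidean space over sign patterns.
  let U : ι → EuclideanSpace ℝ (ι → ℤˣ) := fun j =>
    WithLp.toLp 2 fun s => Real.sqrt (μ s) * ((s j : ℤ) : ℝ)
  have hU : ∀ c : ι → ℝ, ‖∑ j, c j • U j‖ ^ 2 = ∑ s, μ s * (∑ j, c j * ((s j : ℤ) : ℝ)) ^ 2 := by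
    intro c
    rw [EuclideanSpace.real_norm_sq_eq]
    refine Finset.sum_congr rfl fun s _ => ?_
    have : (∑ j, c j • U j) s = Real.sqrt (μ s) * ∑ j, c j * ((s j : ℤ) : ℝ) := by
      simp [U, Finset.mul_sum, mul_left_comm]
    rw [this, mul_pow, Real.sq_sqrt (h0 s)]
  obtain ⟨u, hu⟩ := exists_euclidean_realization U
  have hunit : ∀ j, ‖u j‖ = 1 := by
    intro j
    have e1 := hu (Pi.single j 1)
    have e2 := hU (Pi.single j 1)
    have hs : ∀ s : ι → ℤˣ, (((s j : ℤ) : ℝ)) ^ 2 = 1 := fun s => by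
      rcases Int.units_eq_one_or (s j) with h | h <;> simp [h]
    simp only [Pi.single_apply, ite_smul, one_smul, zero_smul, Finset.sum_ite_eq',
      Finset.mem_univ, if_true, ite_mul, one_mul, zero_mul, hs, mul_one, h1] at e1 e2
    rw [e1]
    exact (pow_eq_one_iff_of_nonneg (norm_nonneg _) two_ne_zero).1 e2
  refine (ciInf_le ⟨_, (HerDisc.vecdisc_attained A).2⟩
    (fun j => ⟨u j, by simpa using hunit j⟩)).trans ?_
  refine Real.iSup_le (fun i => ?_) hr
  refine le_trans ?_ (hf i)
  rw [hu, ← sq_le_sq₀ (norm_nonneg _) (norm_nonneg _), hU]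
  refine le_of_eq_of_le ?_ (hcov (f i))
  refine Finset.sum_congr rfl fun s _ => ?_
  simp [sum_inner, real_inner_smul_left, hA, mul_comm]

theorem disc_le_of_factorization (hm : 2 ≤ m) (hA : ∀ i j, A i j = inner ℝ (v j) (f i))
    (hv : ∀ j, ‖v j‖ ≤ 1) (hr : 0 ≤ r) (hf : ∀ i, ‖f i‖ ≤ r) :
    HerDisc.disc A ≤ 292 * Real.sqrt (Real.log m) * r := by
  classical
  have hm' : (2 : ℝ) ≤ m := by exact_mod_cast hm
  have hlog : 0 < Real.log m := Real.log_pos (by linarith)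
  obtain ⟨x, hx, hbound⟩ : ∃ x : ι → ℝ, (∀ j, x j = 1 ∨ x j = -1) ∧
      ∀ i, |(A *ᵥ x) i| ≤ 292 * Real.sqrt (Real.log m) * r := by
    have hmul : ∀ (x : ι → ℝ) i, (A *ᵥ x) i = inner ℝ (∑ j, x j • v j) (f i) := fun x i => by
      simp [Matrix.mulVec, dotProduct, sum_inner, real_inner_smul_left, hA, mul_comm]
    rcases hr.eq_or_lt with rfl | hr
    · refine ⟨fun _ => 1, fun _ => Or.inl rfl, fun i => ?_⟩
      have : f i = 0 := norm_le_zero_iff.1 (hf i)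
      simp [hmul, this]
    obtain ⟨μ, h0, h1, -, hexp⟩ := exists_subgaussian_signs hv
    set t : ℝ := Real.sqrt (Real.log m) with ht
    have ht0 : 0 < t := Real.sqrt_pos.2 hlog
    have ht2 : t ^ 2 = Real.log m := Real.sq_sqrt hlog.le
    -- The scale that balances the union bound over `2 * m` tails against the subgaussian bound.
    set c : ℝ := t / r with hc
    have hc0 : 0 < c := div_pos ht0 hr
    let g : (ι → ℤˣ) → ℝ := fun s => ∑ i,
      (Real.exp (inner ℝ (∑ j, ((s j : ℤ) : ℝ) • v j) (c • f i))
        + Real.exp (inner ℝ (∑ j, ((s j : ℤ) : ℝ) • v j) (-(c • f i))))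
    have hθ : ∀ i, ‖c • f i‖ ^ 2 ≤ t ^ 2 := fun i => by
      refine pow_le_pow_left₀ (norm_nonneg _) ?_ 2
      rw [norm_smul, Real.norm_of_nonneg hc0.le]
      calc c * ‖f i‖ ≤ c * r := by gcongr; exact hf i
        _ = t := div_mul_cancel₀ t hr.ne'
    have hg : ∑ s, μ s * g s ≤ Real.exp (292 * t ^ 2) := by
      calc ∑ s, μ s * g s = ∑ i,
            (∑ s, μ s * Real.exp (inner ℝ (∑ j, ((s j : ℤ) : ℝ) • v j) (c • f i))
              + ∑ s, μ s * Real.exp (inner ℝ (∑ j, ((s j : ℤ) : ℝ) • v j) (-(c • f i)))) := by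
            simp only [g, Finset.mul_sum]
            rw [Finset.sum_comm]
            simp only [mul_add, Finset.sum_add_distrib]
        _ ≤ ∑ i : Fin m, (Real.exp (290 * t ^ 2) + Real.exp (290 * t ^ 2)) := by
            refine Finset.sum_le_sum fun i _ => add_le_add ?_ ?_
            · exact (hexp _).trans (Real.exp_le_exp.2 (by linarith [hθ i]))
            · refine (hexp _).trans (Real.exp_le_exp.2 ?_)
              rw [norm_neg]
              linarith [hθ i]
        _ = 2 * m * Real.exp (290 * t ^ 2) := by
            simp
            ring
        _ ≤ m * m * Real.exp (290 * t ^ 2) := by gcongr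
        _ = Real.exp (292 * t ^ 2) := by
            rw [← Real.exp_log (by linarith : (0 : ℝ) < m), ← ht2, ← Real.exp_add, ← Real.exp_add]
            ring_nf
    obtain ⟨s, hs⟩ : ∃ s, g s ≤ Real.exp (292 * t ^ 2) := by
      by_contra! hcon
      obtain ⟨s, -, hs⟩ := Finset.exists_ne_zero_of_sum_ne_zero (h1.trans_ne one_ne_zero)
      have : ∑ s, μ s * Real.exp (292 * t ^ 2) < ∑ s, μ s * g s :=
        Finset.sum_lt_sum (fun s _ => mul_le_mul_of_nonneg_left (hcon s).le (h0 s))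
          ⟨s, Finset.mem_univ s, mul_lt_mul_of_pos_left (hcon s) ((h0 s).lt_of_ne' hs)⟩
      rw [← Finset.sum_mul, h1, one_mul] at this
      linarith
    refine ⟨fun j => ((s j : ℤ) : ℝ), fun j => ?_, fun i => ?_⟩
    · rcases Int.units_eq_one_or (s j) with h | h <;> simp [h]
    rw [hmul]
    have hi := (Finset.single_le_sum (f := fun i =>
      Real.exp (inner ℝ (∑ j, ((s j : ℤ) : ℝ) • v j) (c • f i))
        + Real.exp (inner ℝ (∑ j, ((s j : ℤ) : ℝ) • v j) (-(c • f i))))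
      (fun i _ => by positivity) (Finset.mem_univ i)).trans hs
    simp only [inner_neg_right, real_inner_smul_right] at hi
    set y := inner ℝ (∑ j, ((s j : ℤ) : ℝ) • v j) (f i)
    have hp : c * y ≤ 292 * t ^ 2 := Real.exp_le_exp.1 (by linarith [Real.exp_pos (-(c * y))])
    have hn : -(c * y) ≤ 292 * t ^ 2 := Real.exp_le_exp.1 (by linarith [Real.exp_pos (c * y)])
    have hct : 292 * t ^ 2 = c * (292 * t * r) := by
      rw [hc]
      field_simp
    rw [abs_le]
    constructor
    · refine le_of_mul_le_mul_left ?_ hc0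
      linarith
    · refine le_of_mul_le_mul_left ?_ hc0
      linarith
  refine ((HerDisc.disc_attained A).2 ⟨x, hx, rfl⟩).trans ?_
  exact (pi_norm_le_iff_of_nonneg (by positivity)).2 hbound

end Discrepancy

/-! ### Ellipsoids -/

section Ellipsoid

variable {m n : ℕ} (F : Matrix (Fin m) (Fin m) ℝ)

theorem linftyNorm_ellipsoid_nonneg : 0 ≤ HerDisc.linftyNorm (HerDisc.ellipsoid F) := by
  obtain ⟨y, -, hy⟩ := (HerDisc.linftyNorm_ellipsoid_attained F).1
  exact hy ▸ norm_nonneg y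

/-- The `i`-th coordinate on the ellipsoid attains the Euclidean norm of the `i`-th row. -/
theorem norm_row_le_linftyNorm (i : Fin m) :
    ‖(WithLp.toLp 2 (F i) : EuclideanSpace ℝ (Fin m))‖
      ≤ HerDisc.linftyNorm (HerDisc.ellipsoid F) := by
  set f : EuclideanSpace ℝ (Fin m) := WithLp.toLp 2 (F i) with hf
  rcases eq_or_ne f 0 with h | h
  · rw [h, norm_zero]
    exact linftyNorm_ellipsoid_nonneg F
  have hpos : 0 < ‖f‖ := norm_pos_iff.2 h
  have hmem : F *ᵥ (‖f‖⁻¹ • f).ofLp ∈ HerDisc.ellipsoid F := by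
    refine ⟨‖f‖⁻¹ • f, ?_, rfl⟩
    simp [norm_smul, hpos.ne']
  have hcoord : (F *ᵥ (‖f‖⁻¹ • f).ofLp) i = ‖f‖ := by
    have : (F *ᵥ (‖f‖⁻¹ • f).ofLp) i = ‖f‖⁻¹ * ‖f‖ ^ 2 := by
      have hsum : (F *ᵥ (‖f‖⁻¹ • f).ofLp) i = ∑ k, F i k * (‖f‖⁻¹ • f).ofLp k := rfl
      rw [hsum, EuclideanSpace.real_norm_sq_eq, Finset.mul_sum]
      refine Finset.sum_congr rfl fun k _ => ?_
      simp only [hf, PiLp.smul_apply, smul_eq_mul]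
      ring
    rw [this]
    field_simp
  calc ‖f‖ = ‖(F *ᵥ (‖f‖⁻¹ • f).ofLp) i‖ := by rw [hcoord, norm_norm]
    _ ≤ ‖F *ᵥ (‖f‖⁻¹ • f).ofLp‖ := norm_le_pi_norm _ i
    _ ≤ _ := (HerDisc.linftyNorm_ellipsoid_attained F).2 ⟨_, hmem, rfl⟩

variable {F}

theorem exists_factorization {A : Matrix (Fin m) (Fin n) ℝ}
    (hA : ∀ j : Fin n, (fun i => A i j) ∈ HerDisc.ellipsoid F) :
    ∃ v : Fin n → EuclideanSpace ℝ (Fin m), (∀ j, ‖v j‖ ≤ 1) ∧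
      ∀ i j, A i j = inner ℝ (v j) (WithLp.toLp 2 (F i) : EuclideanSpace ℝ (Fin m)) := by
  choose v hv hvA using hA
  refine ⟨v, fun j => by simpa using hv j, fun i j => ?_⟩
  have := congrFun (hvA j) i
  simp only at this
  rw [← this, EuclideanSpace.inner_eq_star_dotProduct]
  simp [Matrix.mulVec]

end Ellipsoid

theorem theorem3p3 :
    (∀ (m n : ℕ) (A : Matrix (Fin m) (Fin n) ℝ) (F : Matrix (Fin m) (Fin m) ℝ),
      F.rank = m → (∀ j : Fin n, (fun i => A i j) ∈ HerDisc.ellipsoid F) →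
        HerDisc.hvecdisc A ≤ HerDisc.linftyNorm (HerDisc.ellipsoid F)) ∧
    (∃ C : ℝ, 0 < C ∧
      ∀ (m n : ℕ) (A : Matrix (Fin m) (Fin n) ℝ) (F : Matrix (Fin m) (Fin m) ℝ),
        2 ≤ m → F.rank = m → (∀ j : Fin n, (fun i => A i j) ∈ HerDisc.ellipsoid F) →
          HerDisc.herdisc A ≤
            C * Real.sqrt (Real.log (m : ℝ)) * HerDisc.linftyNorm (HerDisc.ellipsoid F)) := by
  refine ⟨fun m n A F _ hA => ?_, 292, by norm_num, fun m n A F hm _ hA => ?_⟩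
  · obtain ⟨v, hv, hvA⟩ := exists_factorization hA
    exact ciSup_le fun S => vecdisc_le_of_factorization (v := fun j : S => v j)
      (fun i j => hvA i j) (fun j => hv j) (linftyNorm_ellipsoid_nonneg F)
      (norm_row_le_linftyNorm F)
  · obtain ⟨v, hv, hvA⟩ := exists_factorization hA
    exact ciSup_le fun S => disc_le_of_factorization (v := fun j : S => v j) hm
      (fun i j => hvA i j) (fun j => hv j) (linftyNorm_ellipsoid_nonneg F)
      (norm_row_le_linftyNorm F)
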